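/- Let $X$ be a locally compact Hausdorff space, and let $C_p(X)$ be the space of all continuous functions $X\to\mathbb R$ with the topology of pointwise convergence. Then $C_p(X)$ is an Ascoli space if and only if $X$ is scattered. Here a topological space $Y$ is called an Ascoli space if every compact subset $K$ of $C_k(Y)$ (the space of all continuous functions $Y\to\mathbb R$ with the compact-open topology) is evenly continuous, that is, the evaluation map $Y\times K\to\mathbb R$, $(y,f)\mapsto f(y)$, is continuous; and $X$ is called scattered if every non-empty subspace $A$ of $X$ has a point that is isolated in $A$. -/

import Mathlib

/-- The space `C_p(X)`: all continuous real-valued functions on `X` with the topology of pointwise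
convergence, i.e. the subspace topology inherited from the product space `X → ℝ`. -/
abbrev CpSpace (X : Type*) [TopologicalSpace X] : Type _ :=
  {f : X → ℝ // Continuous f}

/-- A set `K` of continuous real-valued functions on `Y` is evenly continuous if the evaluation map
`Y × K → ℝ`, `(y, f) ↦ f y`, is jointly continuous. Here `K` carries the subspace topology of
`C_k(Y)`, the space `C(Y, ℝ)` with its compact-open topology. -/
def IsEvenlyContinuous {Y : Type*} [TopologicalSpace Y] (K : Set C(Y, ℝ)) : Prop :=
  Continuous fun p : Y × K => (p.2 : C(Y, ℝ)) p.1

/-- `Y` is an Ascoli space if every compact subset of `C_k(Y)` is evenly continuous. -/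
def IsAscoli (Y : Type*) [TopologicalSpace Y] : Prop :=
  ∀ K : Set C(Y, ℝ), IsCompact K → IsEvenlyContinuous K

/-- `X` is scattered if every non-empty subspace `A` of `X` has a point isolated in `A`. -/
def IsScattered (X : Type*) [TopologicalSpace X] : Prop :=
  ∀ A : Set X, A.Nonempty → ∃ a : A, IsOpen ({a} : Set A)

/-!
The equivalence rests on two facts about a locally compact Hausdorff space `X`.

*Scattered implies Ascoli.* A continuous image of a compact scattered space in a second countable
Hausdorff space is countable (`IsScattered.countable_image`): otherwise the image contains a
nonempty perfect set `D`, and a minimal closed set whose image contains `D` has an isolated point,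
which maps to an isolated point of `D`. Using compactly supported functions, any countable set is
therefore mapped injectively by a continuous map `f` from `X` to a metrizable space with `range f` countable.
In a countable `T₁` space `{m₀, m₁, …}`, pairwise disjoint finite sets `Eₙ` have the point-finite
open neighbourhoods obtained by deleting `m₀, …, mₙ` except for the points of `Eₙ`; pulling back
gives `IsScattered.exists_pointFinite_open_superset`. Given `f` in the closure of an open set `U`
of `C_p(X)`, this allows one to modify a sequence in `U` that is close to `f` on a growing sequence
of finite sets only, so that it converges to `f` pointwise. Hence `C_p(X)` is
κ-Fréchet–Urysohn, and every such space is Ascoli (`IsKappaFrechetUrysohn.isAscoli`).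

*Ascoli implies scattered.* If `X` is not scattered, it contains a nonempty compact perfect set;
splitting it repeatedly and passing to a minimal closed set that meets all the pieces gives a
nonempty compact `K` and finite sets `Fₙ ⊆ K` such that every point lies in finitely many `Fₙ`
and every open set meeting `K` meets almost all `Fₙ` (`exists_finset_seq_of_not_isScattered`).
Let `φₙ : C_p(X) → ℝ` be a continuous function that vanishes outside `{g | g > n on Fₙ}` and is `1`
where `g ≥ n + 1` on `Fₙ`. By the Baire category theorem in `K`, a pointwise bounded set of
functions meets only finitely many of these supports, so `φₙ → 0` in the compact-open topology.
But every neighbourhood of `0` in `C_p(X)` contains, for large `n`, some `g` with `φₙ g = 1`, so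
the compact set `{0} ∪ {φₙ}` is not evenly continuous.
-/

open Set Filter Topology

/-! ### Minimal closed sets -/

/-- A compact set meeting all members of a family of closed sets contains a minimal closed set with
that property. Minimality is stated in the form in which it is used: every open set meeting `A`
contains the trace on `A` of some member of the family. -/
theorem exists_minimal_closed_meeting {X ι : Type*} [TopologicalSpace X] {K : Set X}
    (hK : IsCompact K) (hKc : IsClosed K) {C : ι → Set X} (hC : ∀ i, IsClosed (C i))
    (h : ∀ i, (K ∩ C i).Nonempty) :
    ∃ A ⊆ K, IsClosed A ∧ (∀ i, (A ∩ C i).Nonempty) ∧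
      ∀ V, IsOpen V → (A ∩ V).Nonempty → ∃ i, A ∩ C i ⊆ V := by
  obtain ⟨A, hAK, hA⟩ := zorn_superset_nonempty
    {A : Set X | IsClosed A ∧ A ⊆ K ∧ ∀ i, (A ∩ C i).Nonempty} (by
      intro c hc hchain hne
      have hmem : ∀ s ∈ c, ⋂₀ c ⊆ s := fun s hs => sInter_subset_of_mem hs
      refine ⟨⋂₀ c, ⟨isClosed_sInter fun s hs => (hc hs).1, ?_, fun i => ?_⟩, hmem⟩
      · obtain ⟨s, hs⟩ := hne
        exact (hmem s hs).trans (hc hs).2.1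
      · have := hne.to_subtype
        have key := IsCompact.nonempty_iInter_of_directed_nonempty_isCompact_isClosed
          (fun s : c => (s : Set X) ∩ C i)
          (by
            intro s t
            rcases hchain.total s.2 t.2 with hst | hts
            · exact ⟨s, Subset.rfl, inter_subset_inter_left _ hst⟩
            · exact ⟨t, inter_subset_inter_left _ hts, Subset.rfl⟩)
          (fun s => (hc s.2).2.2 i)
          (fun s => (hK.of_isClosed_subset (hc s.2).1 (hc s.2).2.1).inter_right (hC i))
          (fun s => (hc s.2).1.inter (hC i))
        rwa [← iInter_inter, ← sInter_eq_iInter] at key)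
    K ⟨hKc, Subset.rfl, h⟩
  refine ⟨A, hAK, hA.1.1, hA.1.2.2, fun V hV ⟨x, hxA, hxV⟩ => ?_⟩
  by_contra! hcon
  have hsub : A ⊆ A \ V := hA.2 ⟨hA.1.1.sdiff hV, sdiff_subset.trans hAK, fun i => by
    obtain ⟨y, hy, hyV⟩ := not_subset.1 (hcon i)
    exact ⟨y, ⟨hy.1, hyV⟩, hy.2⟩⟩ sdiff_subset
  exact (hsub hxA).2 hxV

/-! ### Scattered spaces -/

theorem IsScattered.countable_image {X Z : Type*} [TopologicalSpace X] [T2Space X]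
    [TopologicalSpace Z] [T2Space Z] [SecondCountableTopology Z] (hX : IsScattered X)
    {K : Set X} (hK : IsCompact K) {f : X → Z} (hf : Continuous f) : (f '' K).Countable := by
  by_contra hunc
  obtain ⟨D, hD, hDne, hDK⟩ :=
    exists_perfect_nonempty_of_isClosed_of_not_countable (hK.image hf).isClosed hunc
  -- a minimal closed subset of `K` that is mapped onto a set containing `D`
  obtain ⟨A, hAK, hA, hmeet, hmin⟩ := exists_minimal_closed_meeting hK hK.isClosed
    (C := fun z : D => f ⁻¹' {(z : Z)}) (fun z => isClosed_singleton.preimage hf) (by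
      rintro ⟨z, hz⟩
      obtain ⟨x, hx, rfl⟩ := hDK hz
      exact ⟨x, hx, rfl⟩)
  obtain ⟨z₀, hz₀⟩ := hDne
  obtain ⟨⟨a, ha⟩, hopen⟩ := hX A ((hmeet ⟨z₀, hz₀⟩).mono inter_subset_left)
  obtain ⟨V, hV, hVa⟩ := isOpen_induced_iff.1 hopen
  have hVa' : ∀ x ∈ A, x ∈ V ↔ x = a := fun x hx => by
    simpa [Subtype.ext_iff] using Set.ext_iff.1 hVa ⟨x, hx⟩
  obtain ⟨⟨z, hz⟩, hzV⟩ := hmin V hV ⟨a, ha, (hVa' a ha).2 rfl⟩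
  -- `f '' (A \ V)` is closed, omits `z = f a` and covers the rest of `D`, so `z` is isolated in `D`
  have hclosed : IsClosed (f '' (A \ V)) :=
    ((hK.of_isClosed_subset hA hAK).diff hV |>.image hf).isClosed
  have hza : z ∉ f '' (A \ V) := by
    rintro ⟨x, hx, rfl⟩
    exact hx.2 (hzV ⟨hx.1, rfl⟩)
  have hfa : f a = z := by
    obtain ⟨x, hx, hxz⟩ := hmeet ⟨z, hz⟩
    rwa [← (hVa' x hx).1 (hzV ⟨hx, hxz⟩)]
  obtain ⟨y, ⟨hy, hyD⟩, hyz⟩ := accPt_iff_nhds.1 (hD.acc z hz) _ (hclosed.isOpen_compl.mem_nhds hza)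
  obtain ⟨x, hx, hxy⟩ := hmeet ⟨y, hyD⟩
  refine hy ⟨x, ⟨hx, fun hxV => hyz ?_⟩, hxy⟩
  rw [← hfa, ← (hVa' x hx).1 hxV]
  exact hxy.symm

/-- The map collects, for each pair of distinct points of `D`, a compactly supported function
separating them. All points outside the countably many supports have the image `0`, and each
support has a countable image. -/
theorem IsScattered.exists_continuous_injOn_countable_range {X : Type*} [TopologicalSpace X]
    [T2Space X] [LocallyCompactSpace X] (hX : IsScattered X) {D : Set X} (hD : D.Countable) :
    ∃ f : X → (D × D → ℝ), Continuous f ∧ InjOn f D ∧ (range f).Countable := by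
  have hsep : ∀ p : D × D, ∃ φ : C(X, ℝ), HasCompactSupport φ ∧
      (p.1 ≠ p.2 → φ p.1 = 1 ∧ φ p.2 = 0) := by
    rintro ⟨d, e⟩
    by_cases hde : d = e
    · exact ⟨0, HasCompactSupport.zero, fun h => (h hde).elim⟩
    · obtain ⟨φ, h1, h0, hφ, -⟩ := exists_continuous_one_zero_of_isCompact
        (isCompact_singleton (x := (d : X))) (isClosed_singleton (x := (e : X)))
        (disjoint_singleton.2 fun h => hde (Subtype.ext h))
      exact ⟨φ, hφ, fun _ => ⟨h1 rfl, h0 rfl⟩⟩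
  choose φ hφ hφsep using hsep
  have := hD.to_subtype
  have hcont : Continuous fun x p => φ p x := continuous_pi fun p => (φ p).continuous
  refine ⟨fun x p => φ p x, hcont, fun d hd e he hde => ?_, ?_⟩
  · by_contra hne
    obtain ⟨h1, h0⟩ := hφsep (⟨d, hd⟩, ⟨e, he⟩) (fun h => hne (Subtype.ext_iff.1 h))
    have := congrFun hde (⟨d, hd⟩, ⟨e, he⟩)
    simp only at this h1 h0
    rw [h1, h0] at this
    exact one_ne_zero this
  · refine ((countable_iUnion fun p => hX.countable_image (hφ p) hcont).insert 0).mono ?_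
    rintro _ ⟨x, rfl⟩
    by_cases hx : ∃ p, x ∈ tsupport (φ p)
    · obtain ⟨p, hp⟩ := hx
      exact Or.inr (mem_iUnion.2 ⟨p, x, hp, rfl⟩)
    · push Not at hx
      exact Or.inl (funext fun p => image_eq_zero_of_notMem_tsupport (hx p))

/-- Pairwise disjoint finite subsets of a locally compact scattered space have point-finite open
neighbourhoods. -/
theorem IsScattered.exists_pointFinite_open_superset {X : Type*} [TopologicalSpace X]
    [T2Space X] [LocallyCompactSpace X] (hX : IsScattered X) (E : ℕ → Finset X)
    (hE : Pairwise fun m n => Disjoint (E m) (E n)) :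
    ∃ U : ℕ → Set X, (∀ n, IsOpen (U n)) ∧ (∀ n, ↑(E n) ⊆ U n) ∧
      ∀ x, ∀ᶠ n in atTop, x ∉ U n := by
  obtain ⟨f, hf, hinj, hcount⟩ := hX.exists_continuous_injOn_countable_range
    (countable_iUnion fun n => (E n).countable_toSet)
  have hED : ∀ n, ∀ x ∈ E n, x ∈ ⋃ n, (E n : Set X) := fun n x hx => mem_iUnion.2 ⟨n, hx⟩
  obtain hemp | hne := isEmpty_or_nonempty X
  · exact ⟨fun _ => ∅, fun _ => isOpen_empty, fun _ x => (hemp.false x).elim,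
      fun x => (hemp.false x).elim⟩
  obtain ⟨m, hm⟩ := hcount.exists_eq_range (range_nonempty f)
  -- `f x = m j` lies in the `n`-th set for `n ≥ j` only if `f x ∈ f '' E n`, hence for at most one `n`
  refine ⟨fun n => f ⁻¹' ((m '' Iic n) \ (f '' E n))ᶜ, fun n => ?_, fun n x hx => ?_, fun x => ?_⟩
  · exact (((finite_Iic n).image m).sdiff).isClosed.isOpen_compl.preimage hf
  · exact fun h => h.2 ⟨x, hx, rfl⟩
  · obtain ⟨j, hj⟩ := hm.subset (mem_range_self x)
    have hev : ∀ᶠ n in atTop, f x ∉ f '' E n := by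
      by_cases hx : ∃ k, f x ∈ f '' E k
      · obtain ⟨k, y, hy, hyx⟩ := hx
        filter_upwards [eventually_ne_atTop k] with n hnk
        rintro ⟨z, hz, hzx⟩
        have : z = y := hinj (hED n z hz) (hED k y hy) (hzx.trans hyx.symm)
        exact Finset.disjoint_left.1 (hE hnk) hz (this ▸ hy)
      · exact Eventually.of_forall fun n h => hx ⟨n, h⟩
    filter_upwards [hev, eventually_ge_atTop j] with n hn hjn
    exact fun h => h ⟨⟨j, hjn, hj⟩, hn⟩

/-! ### Sequential approximation from open sets -/

/-- A space is κ-Fréchet–Urysohn if every point of the closure of an open set is the limit of a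
sequence in that open set. -/
def IsKappaFrechetUrysohn (Y : Type*) [TopologicalSpace Y] : Prop :=
  ∀ U : Set Y, IsOpen U → ∀ y ∈ closure U, ∃ u : ℕ → Y, (∀ n, u n ∈ U) ∧ Tendsto u atTop (𝓝 y)

/-- If even continuity failed at `(y₀, f₀)`, there would be `uₙ → y₀` and `fₙ ∈ K` with `fₙ y₀` close
to `f₀ y₀` but `fₙ uₙ` not; a cluster point of `fₙ` in `K` contradicts this on the compact set
formed by `y₀` and a tail of `u`. -/
theorem IsKappaFrechetUrysohn.isAscoli {Y : Type*} [TopologicalSpace Y]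
    (hY : IsKappaFrechetUrysohn Y) : IsAscoli Y := by
  intro K hK
  refine continuous_iff_continuousAt.2 fun ⟨y₀, f₀⟩ => ?_
  set c : ℝ := (f₀ : C(Y, ℝ)) y₀ with hc
  refine Metric.nhds_basis_closedBall.tendsto_right_iff.2 fun ε hε => ?_
  set U : Set Y := {y | ∃ f ∈ K, dist (f y₀) c < ε / 2 ∧ ε < dist (f y) c} with hUdef
  have hU : IsOpen U := by
    have : U = ⋃ f ∈ {f ∈ K | dist (f y₀) c < ε / 2}, {y | ε < dist (f y) c} := by
      ext y
      simp [hUdef, and_assoc]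
    rw [this]
    exact isOpen_biUnion fun f _ => isOpen_lt continuous_const (by fun_prop)
  have hy₀ : y₀ ∉ closure U := by
    intro hcl
    obtain ⟨u, huU, hu⟩ := hY U hU y₀ hcl
    choose f hfK hf₀ hfu using huU
    obtain ⟨g, hgK, hg⟩ := hK.exists_mapClusterPt (u := f) (f := atTop)
      (tendsto_principal.2 (Eventually.of_forall hfK))
    have hg₀ : dist (g y₀) c ≤ ε / 2 := by
      by_contra! hlt
      have hopen : IsOpen {h : C(Y, ℝ) | ε / 2 < dist (h y₀) c} :=
        isOpen_lt continuous_const ((continuous_eval_const y₀).dist continuous_const)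
      obtain ⟨n, hn⟩ := (hg.frequently (hopen.mem_nhds hlt)).exists
      exact lt_asymm hn (hf₀ n)
    obtain ⟨N, hN⟩ : ∃ N, ∀ n ≥ N, dist (g (u n)) c < ε := eventually_atTop.1 <|
      hu.eventually <| (isOpen_lt (g.continuous.dist continuous_const) continuous_const).mem_nhds
        (show dist (g y₀) c < ε by linarith)
    have hS : IsCompact (insert y₀ (range fun n => u (n + N))) :=
      (hu.comp (tendsto_add_atTop_nat N)).isCompact_insert_range
    have hgS : MapsTo g (insert y₀ (range fun n => u (n + N))) (Metric.ball c ε) := by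
      rintro _ (rfl | ⟨n, rfl⟩)
      · exact hg₀.trans_lt (by linarith)
      · exact hN _ (Nat.le_add_left _ _)
    obtain ⟨n, hn, hNn⟩ := ((hg.frequently ((ContinuousMap.isOpen_setOfPred_mapsTo hS
      Metric.isOpen_ball).mem_nhds hgS)).and_eventually (eventually_ge_atTop N)).exists
    have := hn (Or.inr ⟨n - N, by simp [Nat.sub_add_cancel hNn]⟩ :
      u n ∈ insert y₀ (range fun n => u (n + N)))
    exact lt_asymm this (hfu n)
  have h1 : ∀ᶠ y in 𝓝 y₀, y ∉ U := by
    filter_upwards [isClosed_closure.isOpen_compl.mem_nhds hy₀] with y hy hyU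
    exact hy (subset_closure hyU)
  have h2 : ∀ᶠ f : K in 𝓝 f₀, dist ((f : C(Y, ℝ)) y₀) c < ε / 2 :=
    (isOpen_lt (((continuous_eval_const y₀).comp continuous_subtype_val).dist
      continuous_const) continuous_const).mem_nhds (by simpa [hc] using hε)
  rw [nhds_prod_eq]
  filter_upwards [h1.prod_mk h2] with p hp
  exact not_lt.1 fun hlt => hp.1 ⟨p.2, p.2.2, hp.2, hlt⟩

/-! ### The space of continuous functions with the pointwise topology -/

theorem CpSpace.exists_finset_of_mem_nhds {X : Type*} [TopologicalSpace X] {g : CpSpace X}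
    {U : Set (CpSpace X)} (hU : U ∈ 𝓝 g) :
    ∃ A : Finset X, ∃ ε > 0, ∀ h : CpSpace X, (∀ x ∈ A, dist (h.1 x) (g.1 x) < ε) → h ∈ U := by
  obtain ⟨t, ht, htU⟩ := mem_nhds_induced _ _ _ |>.1 hU
  rw [nhds_pi] at ht
  obtain ⟨⟨I, r⟩, ⟨hI, hr⟩, hIr⟩ :=
    (hasBasis_pi fun x => Metric.nhds_basis_ball (x := g.1 x)).mem_iff.1 ht
  have hε : ∀ᶠ ε : ℝ in 𝓝[>] 0, ∀ x ∈ I, ε < r x := (eventually_all_finite hI).2 fun x hx =>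
    nhdsWithin_le_nhds (Iio_mem_nhds (hr x hx))
  obtain ⟨ε, hε, hε0⟩ := (hε.and self_mem_nhdsWithin).exists
  refine ⟨hI.toFinset, ε, hε0, fun h hh => htU (hIr fun x hx => ?_)⟩
  exact (hh x (hI.mem_toFinset.2 hx)).trans (hε x hx)

/-- The approximating sequence `h n` agrees with some `g n ∈ U` on a finite set that forces `h n ∈ U`.
On the part of that set where `g n` need not be close to `f`, the agreement is arranged inside
point-finite open sets; elsewhere the difference `g n - f` is truncated at `±1 / (n + 1)`. -/
theorem IsScattered.isKappaFrechetUrysohn_cpSpace {X : Type*} [TopologicalSpace X]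
    [T2Space X] [LocallyCompactSpace X] (hX : IsScattered X) :
    IsKappaFrechetUrysohn (CpSpace X) := by
  classical
  intro U hU f hf
  -- `g` is close to `f` on `A`, and agreeing with `g` on the finite set `B ⊇ A` implies being in `U`
  have step : ∀ (A : Finset X) (n : ℕ), ∃ g ∈ U, ∃ B : Finset X, A ⊆ B ∧
      (∀ x ∈ A, dist (g.1 x) (f.1 x) < 1 / ((n : ℝ) + 1)) ∧
      ∀ h : CpSpace X, (∀ x ∈ B, h.1 x = g.1 x) → h ∈ U := by
    intro A n
    have hnhds : {g : CpSpace X | ∀ x ∈ A, dist (g.1 x) (f.1 x) < 1 / ((n : ℝ) + 1)} ∈ 𝓝 f := by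
      refine (A.eventually_all).2 fun x _ => ?_
      have hcx : Continuous fun g : CpSpace X => dist (g.1 x) (f.1 x) :=
        ((continuous_apply x).comp continuous_subtype_val).dist continuous_const
      exact (isOpen_lt hcx continuous_const).mem_nhds (by simpa using n.cast_add_one_pos)
    obtain ⟨g, hg, hgU⟩ := mem_closure_iff_nhds.1 hf _ hnhds
    obtain ⟨B, ε, hε, hB⟩ := CpSpace.exists_finset_of_mem_nhds (hU.mem_nhds hgU)
    refine ⟨g, hgU, A ∪ B, Finset.subset_union_left, hg, fun h hh => hB h fun x hx => ?_⟩
    rw [hh x (Finset.mem_union_right _ hx), dist_self]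
    exact hε
  choose g hgU B hAB hgA hB using step
  let A : ℕ → Finset X := Nat.rec ∅ fun n A => B A n
  have hA : ∀ n, A (n + 1) = B (A n) n := fun n => rfl
  have hmono : Monotone A := monotone_nat_of_le_succ fun n => hAB (A n) n
  have hdisj : ∀ m n, m < n → Disjoint (A (m + 1) \ A m) (A (n + 1) \ A n) := fun m n hmn =>
    Finset.disjoint_left.2 fun x hx hx' =>
      (Finset.mem_sdiff.1 hx').2 (hmono hmn (Finset.mem_sdiff.1 hx).1)
  obtain ⟨W, hWo, hEW, hWfin⟩ := hX.exists_pointFinite_open_superset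
    (fun n => A (n + 1) \ A n) (fun m n hmn => by
      rcases hmn.lt_or_gt with h | h
      · exact hdisj m n h
      · exact (hdisj n m h).symm)
  choose χ hχ0 hχ1 hχ using fun n => exists_continuous_zero_one_of_isCompact'
    (A (n + 1) \ A n).finite_toSet.isCompact (hWo n).isClosed_compl
    (disjoint_compl_right_iff_subset.2 (hEW n))
  let r : ℕ → ℝ := fun n => 1 / ((n : ℝ) + 1)
  have hr : ∀ n, 0 < r n := fun n => Nat.one_div_pos_of_nat
  let cl : ℕ → X → ℝ := fun n x => max (-r n) (min (r n) ((g (A n) n).1 x - f.1 x))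
  have hcl : ∀ n, Continuous (cl n) := fun n =>
    continuous_const.max (continuous_const.min ((g (A n) n).2.sub f.2))
  let h : ℕ → CpSpace X := fun n =>
    ⟨fun x => f.1 x + (χ n x * ((g (A n) n).1 x - f.1 x) + (1 - χ n x) * cl n x),
      f.2.add (((χ n).continuous.mul ((g (A n) n).2.sub f.2)).add
        ((continuous_const.sub (χ n).continuous).mul (hcl n)))⟩
  refine ⟨h, fun n => ?_, ?_⟩
  · refine hB (A n) n _ fun x hx => ?_
    obtain hxA | hxA := em (x ∈ A n)
    · have hlt := abs_lt.1 (hgA (A n) n x hxA)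
      have : cl n x = (g (A n) n).1 x - f.1 x := by
        simp only [cl, r]
        rw [min_eq_right hlt.2.le, max_eq_right hlt.1.le]
      simp only [h, this]
      ring
    · have : χ n x = 1 := hχ1 n (Finset.mem_coe.2 (Finset.mem_sdiff.2 ⟨hx, hxA⟩))
      simp only [h, this]
      ring
  · refine tendsto_subtype_rng.2 (tendsto_pi_nhds.2 fun x => ?_)
    refine tendsto_iff_dist_tendsto_zero.2 (squeeze_zero' (Eventually.of_forall fun _ => dist_nonneg)
      ?_ tendsto_one_div_add_atTop_nhds_zero_nat)
    filter_upwards [hWfin x] with n hn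
    have : χ n x = 0 := hχ0 n hn
    simp only [h, this, Real.dist_eq]
    have hle : |cl n x| ≤ r n := abs_le.2
      ⟨le_max_left _ _, max_le (by linarith [hr n]) (min_le_left _ _)⟩
    simpa [r] using hle

/-! ### Non-scattered spaces -/

theorem exists_perfect_of_not_isScattered {X : Type*} [TopologicalSpace X] [T2Space X]
    [LocallyCompactSpace X] (hX : ¬ IsScattered X) :
    ∃ C : Set X, IsCompact C ∧ Perfect C ∧ C.Nonempty := by
  unfold IsScattered at hX
  push Not at hX
  obtain ⟨A, ⟨a, ha⟩, hA⟩ := hX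
  have hpre : Preperfect A := by
    intro x hx
    refine accPt_iff_nhds.2 fun U hU => ?_
    by_contra! hcon
    obtain ⟨V, hVU, hV, hxV⟩ := mem_nhds_iff.1 hU
    refine hA ⟨x, hx⟩ (isOpen_induced_iff.2 ⟨V, hV, ?_⟩)
    ext ⟨y, hy⟩
    simp only [mem_preimage, mem_singleton_iff, Subtype.mk.injEq]
    exact ⟨fun h => hcon y ⟨hVU h, hy⟩, fun h => h ▸ hxV⟩
  obtain ⟨N, hN, haN⟩ := exists_compact_mem_nhds a
  obtain ⟨hp, hne⟩ := hpre.perfect_closure.closure_nhds_inter a (subset_closure ha)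
    (mem_interior_iff_mem_nhds.2 haN) isOpen_interior
  exact ⟨_, hN.of_isClosed_subset isClosed_closure
    (closure_minimal (inter_subset_left.trans interior_subset) hN.isClosed), hp, hne⟩

/-- If some trace `K ∩ C i` were finite, one of least cardinality would contain two disjoint nonempty
traces. -/
theorem infinite_inter_of_forall_exists_disjoint {X ι : Type*} {K : Set X} {C : ι → Set X}
    (hmeet : ∀ i, (K ∩ C i).Nonempty)
    (hsplit : ∀ i, ∃ j k, C j ⊆ C i ∧ C k ⊆ C i ∧ Disjoint (C j) (C k)) (i : ι) :
    (K ∩ C i).Infinite := by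
  intro hfin
  induction hn : (K ∩ C i).ncard using Nat.strong_induction_on generalizing i with
  | _ n ih =>
    obtain ⟨j, k, hj, hk, hjk⟩ := hsplit i
    obtain ⟨x, hxK, hx⟩ := hmeet k
    have hsub : K ∩ C j ⊆ K ∩ C i := inter_subset_inter_right _ hj
    refine ih _ ?_ j (hfin.subset hsub) rfl
    rw [← hn]
    exact ncard_lt_ncard (ssubset_of_subset_of_ne hsub fun heq =>
      disjoint_left.1 hjk (heq.ge ⟨hxK, hk hx⟩ : x ∈ K ∩ C j).2 hx) hfin

theorem exists_finset_seq_meeting {X : Type*} {S : ℕ → Set X} (hS : ∀ i, (S i).Infinite) :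
    ∃ F : ℕ → Finset X, (∀ n, ↑(F n) ⊆ ⋃ i, S i) ∧ (∀ i, ∀ᶠ n in atTop, (↑(F n) ∩ S i).Nonempty) ∧
      ∀ x, ∀ᶠ n in atTop, x ∉ F n := by
  classical
  -- pairs `(k, F)` where `F` meets `S i` for `i < k`; along the sequence `k` grows and the sets `F`
  -- are pairwise disjoint
  obtain ⟨q, hq, hqq⟩ := exists_seq_of_forall_finset_exists
    (fun p : ℕ × Finset X => ↑p.2 ⊆ (⋃ i, S i) ∧ ∀ i < p.1, (↑p.2 ∩ S i).Nonempty)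
    (fun p p' => p.1 < p'.1 ∧ Disjoint p.2 p'.2) (by
      intro s _
      choose x hxS hx using fun i => (hS i).exists_notMem_finset (s.biUnion Prod.snd)
      refine ⟨(s.sup Prod.fst + 1, (Finset.range (s.sup Prod.fst + 1)).image x), ⟨?_, ?_⟩, ?_⟩
      · intro y hy
        obtain ⟨i, -, rfl⟩ := Finset.mem_image.1 (Finset.mem_coe.1 hy)
        exact mem_iUnion.2 ⟨i, hxS i⟩
      · intro i hi
        exact ⟨x i, Finset.mem_coe.2 (Finset.mem_image_of_mem _ (Finset.mem_range.2 hi)), hxS i⟩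
      · intro p hp
        refine ⟨Nat.lt_succ_of_le (Finset.le_sup (f := Prod.fst) hp), ?_⟩
        refine Finset.disjoint_right.2 fun y hy hyp => ?_
        obtain ⟨i, -, rfl⟩ := Finset.mem_image.1 hy
        exact hx i (Finset.mem_biUnion.2 ⟨p, hp, hyp⟩))
  have hmono : StrictMono fun n => (q n).1 := fun m n hmn => (hqq m n hmn).1
  refine ⟨fun n => (q n).2, fun n => (hq n).1, fun i => ?_, fun x => ?_⟩
  · filter_upwards [eventually_gt_atTop i] with n hn
    exact (hq n).2 i (hn.trans_le (hmono.id_le n))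
  · by_cases hx : ∃ k, x ∈ (q k).2
    · obtain ⟨k, hk⟩ := hx
      filter_upwards [eventually_gt_atTop k] with n hn
      exact Finset.disjoint_left.1 (hqq k n hn).2 hk
    · exact Eventually.of_forall fun n h => hx ⟨n, h⟩

/-- In a non-scattered locally compact space there are a nonempty compact set `K` and a point-finite
sequence of finite subsets of `K` of which every open set meeting `K` meets almost all members. -/
theorem exists_finset_seq_of_not_isScattered {X : Type*} [TopologicalSpace X] [T2Space X]
    [LocallyCompactSpace X] (hX : ¬ IsScattered X) :
    ∃ K : Set X, IsCompact K ∧ K.Nonempty ∧ ∃ F : ℕ → Finset X, (∀ n, ↑(F n) ⊆ K) ∧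
      (∀ V, IsOpen V → (K ∩ V).Nonempty → ∀ᶠ n in atTop, (↑(F n) ∩ V).Nonempty) ∧
      ∀ x, ∀ᶠ n in atTop, x ∉ F n := by
  obtain ⟨C, hCcomp, hCperf, hCne⟩ := exists_perfect_of_not_isScattered hX
  have hsplit : ∀ P : {P : Set X // Perfect P ∧ P.Nonempty},
      ∃ Q : Bool → {P : Set X // Perfect P ∧ P.Nonempty},
        (∀ b, (Q b : Set X) ⊆ P) ∧ Disjoint (Q true : Set X) (Q false) := by
    rintro ⟨P, hP, hPne⟩
    obtain ⟨P₀, P₁, ⟨h₀, hne₀, hs₀⟩, ⟨h₁, hne₁, hs₁⟩, hd⟩ := hP.splitting hPne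
    exact ⟨fun b => cond b ⟨P₀, h₀, hne₀⟩ ⟨P₁, h₁, hne₁⟩, by rintro (_ | _) <;> assumption, hd⟩
  choose Q hQ hQd using hsplit
  -- the binary tree of perfect sets obtained by repeated splitting
  let T : List Bool → {P : Set X // Perfect P ∧ P.Nonempty} := fun s =>
    s.foldr (fun b P => Q P b) ⟨C, hCperf, hCne⟩
  have hTC : ∀ s, (T s : Set X) ⊆ C := by
    intro s
    induction s with
    | nil => exact Subset.rfl
    | cons b s ih => exact (hQ (T s) b).trans ih
  obtain ⟨K, hKC, hK, hmeet, hmin⟩ := exists_minimal_closed_meeting hCcomp hCcomp.isClosed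
    (C := fun s => (T s : Set X)) (fun s => (T s).2.1.closed)
    (fun s => by rw [inter_eq_right.2 (hTC s)]; exact (T s).2.2)
  obtain ⟨e, he⟩ := exists_surjective_nat (List Bool)
  have hinf := infinite_inter_of_forall_exists_disjoint hmeet
    (fun s => ⟨true :: s, false :: s, hQ (T s) true, hQ (T s) false, hQd (T s)⟩)
  obtain ⟨F, hFS, hFmeet, hFfin⟩ := exists_finset_seq_meeting fun n => hinf (e n)
  refine ⟨K, hCcomp.of_isClosed_subset hK hKC, (hmeet []).mono inter_subset_left, F,
    fun n => (hFS n).trans (iUnion_subset fun i => inter_subset_left), fun V hV hKV => ?_, hFfin⟩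
  obtain ⟨s, hs⟩ := hmin V hV hKV
  obtain ⟨i, rfl⟩ := he s
  exact (hFmeet i).mono fun n hn => hn.mono (inter_subset_inter_right _ hs)

/-! ### Failure of the Ascoli property -/

theorem IsAscoli.isScattered {X : Type*} [TopologicalSpace X] [T2Space X] [LocallyCompactSpace X]
    (hA : IsAscoli (CpSpace X)) : IsScattered X := by
  by_contra hX
  obtain ⟨K, hK, hKne, F, hFK, hFV, hFfin⟩ := exists_finset_seq_of_not_isScattered hX
  have hev : ∀ x : X, Continuous fun g : CpSpace X => g.1 x := fun x =>
    (continuous_apply x).comp continuous_subtype_val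
  let φ : ℕ → C(CpSpace X, ℝ) := fun n =>
    ⟨fun g => ∏ x ∈ F n, max 0 (min 1 (g.1 x - n)), continuous_finsetProd _ fun x _ =>
      continuous_const.max (continuous_const.min ((hev x).sub continuous_const))⟩
  have hφ0 : ∀ n g, φ n g ≠ 0 → ∀ x ∈ F n, (n : ℝ) < g.1 x := by
    intro n g hne x hx
    by_contra! hle
    refine hne (Finset.prod_eq_zero hx (max_eq_left ?_))
    exact (min_le_right _ _).trans (by linarith)
  have hvanish : ∀ C : Set (CpSpace X), IsCompact C → ∀ᶠ n in atTop, ∀ g ∈ C, φ n g = 0 := by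
    intro C hC
    by_contra hcon
    have hfreq : ∃ᶠ n in atTop, ∃ g ∈ C, φ n g ≠ 0 := by
      simpa [Filter.Frequently] using hcon
    -- a point of all `W m` would be one where the compact set `C` is unbounded
    let W : ℕ → Set K := fun m => {x | ∃ g ∈ C, (m : ℝ) < g.1 x}
    have hWo : ∀ m, IsOpen (W m) := by
      intro m
      have : W m = ⋃ g ∈ C, {x : K | (m : ℝ) < g.1 x} := by
        ext x
        simp [W]
      rw [this]
      exact isOpen_biUnion fun g _ =>
        isOpen_lt continuous_const (g.2.comp continuous_subtype_val)
    have hWd : ∀ m, Dense (W m) := by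
      intro m
      refine dense_iff_inter_open.2 fun O hO ⟨⟨y, hyK⟩, hy⟩ => ?_
      obtain ⟨V, hV, rfl⟩ := isOpen_induced_iff.1 hO
      obtain ⟨n, ⟨g, hgC, hg⟩, ⟨x, hxF, hxV⟩, hmn⟩ := (hfreq.and_eventually
        ((hFV V hV ⟨y, hyK, hy⟩).and (eventually_ge_atTop m))).exists
      exact ⟨⟨x, hFK n hxF⟩, hxV, g, hgC,
        (Nat.cast_le.2 hmn).trans_lt (hφ0 n g hg x hxF)⟩
    have := isCompact_iff_compactSpace.1 hK
    have := hKne.to_subtype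
    obtain ⟨x, hx⟩ := (dense_iInter_of_isOpen_nat hWo hWd).nonempty
    obtain ⟨b, hb⟩ := (hC.image (hev x)).bddAbove
    obtain ⟨m, hm⟩ := exists_nat_ge b
    obtain ⟨g, hgC, hg⟩ := mem_iInter.1 hx m
    exact (hm.trans_lt hg).not_ge (hb ⟨g, hgC, rfl⟩)
  have hlim : Tendsto φ atTop (𝓝 0) := by
    refine ContinuousMap.tendsto_iff_forall_isCompact_tendstoUniformlyOn.2 fun C hC => ?_
    refine Metric.tendstoUniformlyOn_iff.2 fun ε hε => ?_
    filter_upwards [hvanish C hC] with n hn g hg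
    simpa [hn g hg] using hε
  have hcont := hA _ hlim.isCompact_insert_range
  have hnear := (hcont.tendsto (⟨0, continuous_const⟩, ⟨0, mem_insert _ _⟩)).eventually
    (Iio_mem_nhds (show (0 : ℝ) < 1 from one_pos))
  rw [nhds_prod_eq] at hnear
  obtain ⟨p, hp, q, hq, hpq⟩ := eventually_prod_iff.1 hnear
  have hφq : ∀ᶠ n in atTop, q ⟨φ n, Or.inr ⟨n, rfl⟩⟩ :=
    (tendsto_subtype_rng.2 hlim : Tendsto (fun n => (⟨φ n, Or.inr ⟨n, rfl⟩⟩ :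
      ↥(insert 0 (range φ)))) atTop (𝓝 ⟨0, mem_insert _ _⟩)).eventually hq
  obtain ⟨A, ε, hε, hAp⟩ := CpSpace.exists_finset_of_mem_nhds hp
  obtain ⟨n, hn, hnA⟩ := (hφq.and ((A.eventually_all).2 fun x _ => hFfin x)).exists
  -- `(n + 1) * χ` is close to `0` in `C_p(X)`, but `φ n` takes the value `1` there
  obtain ⟨χ, hχ0, hχ1, -⟩ := exists_continuous_zero_one_of_isCompact
    A.finite_toSet.isCompact (F n).finite_toSet.isClosed
    (disjoint_left.2 fun x hx hx' => hnA x hx hx')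
  have hlt := hpq (hAp ⟨fun x => (n + 1) * χ x, by fun_prop⟩ fun x hx => by
    have : χ x = 0 := hχ0 hx
    simpa [this] using hε) hn
  refine (ne_of_lt hlt) (Finset.prod_eq_one fun x hx => ?_)
  have : χ x = 1 := hχ1 hx
  simp [this]

theorem propositionp (X : Type*) [TopologicalSpace X] [T2Space X] [LocallyCompactSpace X] :
    IsAscoli (CpSpace X) ↔ IsScattered X := by
  exact ⟨IsAscoli.isScattered, fun hX => hX.isKappaFrechetUrysohn_cpSpace.isAscoli⟩
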